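/- Consider a dual-hop link with $N\ge 1$ relays, the relay of rank $m$ ($1\le m\le N$) being selected on the basis of outdated channel information with time correlation $\rho\in[0,1]$. The instantaneous SNRs $\gamma_1=\gamma_{1(m)}$ and $\gamma_2=\gamma_{2(m)}$ of the two hops are independent. The RF hop is Rayleigh: $\gamma_1=P_1|h|^2/\sigma_0^2$, where $h$ is the complex fading coefficient, $P_1>0$ the transmit power and $\sigma_0^2>0$ the noise power, and with a scale $\overline\gamma_1>0$ the density of $\gamma_1$ on $[0,\infty)$ is $$f_{\gamma_1}(x)=m\binom Nm\sum_{n=0}^{m-1}\binom{m-1}{n}\frac{(-1)^n}{c_n\overline\gamma_1}\exp\Big(-\frac{(N-m+n+1)x}{c_n\overline\gamma_1}\Big),\qquad c_n=(N-m+n)(1-\rho)+1 .$$ The optical hop is Gamma-Gamma: with $\alpha,\beta,\overline\gamma_2>0$, the density of $\gamma_2$ on $(0,\infty)$ is $$f_{\gamma_2}(x)=\frac{(\alpha\beta)^{\frac{\alpha+\beta}2}x^{\frac{\alpha+\beta}4-1}}{\Gamma(\alpha)\Gamma(\beta)\overline\gamma_2^{\frac{\alpha+\beta}4}}K_{\alpha-\beta}\Big(2\sqrt{\alpha\beta\sqrt{x/\overline\gamma_2}}\Big),$$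 where $K_\nu$ is the modified Bessel function of the second kind. The hardware is described as follows. The destination has IQ-imbalance parameters $\zeta,\theta\in\mathbb R$, with $\omega_1=\frac12(1+\zeta e^{-j\theta})\ne0$, $\omega_2=\frac12(1-\zeta e^{j\theta})$ and $\mathrm{ILR}=|\omega_2/\omega_1|^2$. The amplifier of the relay has linear scale $\delta\neq0$, distortion power $\sigma_d^2\ge0$, mean output power $\sigma^2>0$ and gain $G=\sqrt{\sigma^2/(\mathbb E[|h|^2]P_1+\sigma_0^2)}$. Put $\kappa=1+\sigma_d^2/(\delta^2G^2\sigma_0^2)$ and $$\tau=(1+\mathrm{ILR})\kappa\gamma_2+(1+\mathrm{ILR})(\mathbb E[\gamma_1]+\kappa),\qquad \gamma_{e2e}=\frac{\gamma_1\gamma_2}{\mathrm{ILR}\,\gamma_1\gamma_2+\tau},\qquad \overline C=\tfrac12\,\mathbb E[\log_2(1+\gamma_{e2e})].$$ **Theorem 1.** The expectations $\mathbb E[\gamma_1]$, $\mathbb E[\log_2(1+\gamma_{e2e})]$ and $\mathcal J=\mathbb E\big[\gamma_1\gamma_2/\tau\big]$ are finite, the ergodic capacity satisfies $$\overline C\le\frac12\log_2\Big(1+\frac{\mathcal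 J}{\mathrm{ILR}\,\mathcal J+1}\Big),$$ and $$\mathcal J=\frac{m\binom Nm(\alpha\beta)^{\frac{\alpha+\beta}2}\Big(\frac{\mathbb E[\gamma_1]+\kappa}{\kappa}\Big)^{\frac{\alpha+\beta}4}}{4\pi(1+\mathrm{ILR})\kappa\,\Gamma(\alpha)\Gamma(\beta)\,\overline\gamma_2^{\frac{\alpha+\beta}4}}\sum_{n=0}^{m-1}\binom{m-1}{n}\frac{(-1)^n c_n\overline\gamma_1}{(N-m+n+1)^2}\;G^{5,1}_{1,5}\Big(\tfrac{(\alpha\beta)^2(\mathbb E[\gamma_1]+\kappa)}{16\kappa\overline\gamma_2}\,\Big|\,{\kappa_0\atop\kappa_1}\Big),$$ where $G^{5,1}_{1,5}$ is the Meijer function, $\kappa_0=-\frac{\alpha+\beta}4$ and $\kappa_1=\big(\frac{\alpha-\beta}4,\frac{\alpha-\beta+2}4,\frac{\beta-\alpha}4,\frac{\beta-\alpha+2}4,-\frac{\alpha+\beta}4\big)$. -/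

import Mathlib

open MeasureTheory ProbabilityTheory

/-- Modified Bessel function of the second kind `K_ν(x)`, for real order `ν` and `x > 0`, by
`K_ν(x) = ∫₀^∞ exp (-x cosh t) cosh (ν t) dt`. -/
noncomputable def besselK (ν x : ℝ) : ℝ :=
  ∫ t in Set.Ioi (0 : ℝ), Real.exp (-x * Real.cosh t) * Real.cosh (ν * t)

/-- The integrand of the Mellin-Barnes integral of the Meijer function `G^{m,n}_{p,q}`:
`∏_{j ≤ m} Γ(b_j - s) ∏_{k ≤ n} Γ(1 - a_k + s) /
  (∏_{j > m} Γ(1 - b_j + s) ∏_{k > n} Γ(a_k - s)) * z ^ s`. -/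
noncomputable def meijerGIntegrand (m n : ℕ) {p q : ℕ} (a : Fin p → ℂ) (b : Fin q → ℂ)
    (z s : ℂ) : ℂ :=
  (∏ j : Fin q, if (j : ℕ) < m then Complex.Gamma (b j - s)
    else (Complex.Gamma (1 - b j + s))⁻¹) *
  (∏ k : Fin p, if (k : ℕ) < n then Complex.Gamma (1 - a k + s)
    else (Complex.Gamma (a k - s))⁻¹) * z ^ s

/-- The vertical line `Re s = c` separates the poles of `Γ(b_j - s)`, `j ≤ m` (all strictly to
its right) from those of `Γ(1 - a_k + s)`, `k ≤ n` (all strictly to its left). -/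
def MeijerGSeparates (m n : ℕ) {p q : ℕ} (a : Fin p → ℂ) (b : Fin q → ℂ) (c : ℝ) : Prop :=
  (∀ j : Fin q, (j : ℕ) < m → c < (b j).re) ∧ (∀ k : Fin p, (k : ℕ) < n → (a k).re - 1 < c)

open Classical in
/-- The Meijer function `G^{m,n}_{p,q}(z | a ; b)`, for parameters whose two families of poles can
be separated by a vertical line: the Mellin-Barnes integral `(1 / 2πi) ∫ ds` along such a line,
written with `s = c + i y`. (By Cauchy's theorem the choice of the line is immaterial.) -/
noncomputable def meijerG (m n : ℕ) {p q : ℕ} (a : Fin p → ℂ) (b : Fin q → ℂ) (z : ℂ) : ℂ :=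
  if h : ∃ c : ℝ, MeijerGSeparates m n a b c then
    (1 / (2 * (Real.pi : ℂ))) *
      ∫ y : ℝ, meijerGIntegrand m n a b z ((h.choose : ℂ) + (y : ℂ) * Complex.I)
  else 0

/-- Density of the RF SNR `γ_{1(m)}`: correlated Rayleigh fading, `m`-th worst of `N` relays
selected with outdated channel state information, time correlation `ρ`. -/
noncomputable def rayleighPRSDensity (N m : ℕ) (ρ γb₁ x : ℝ) : ℝ :=
  if 0 ≤ x then
    (m : ℝ) * (N.choose m : ℝ) * ∑ n ∈ Finset.range m,
      (-1 : ℝ) ^ n / ((((N : ℝ) - m + n) * (1 - ρ) + 1) * γb₁) * ((m - 1).choose n : ℝ) *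
        Real.exp (-(((N : ℝ) - m + n + 1) * x) / ((((N : ℝ) - m + n) * (1 - ρ) + 1) * γb₁))
  else 0

/-- Density of the optical SNR `γ_{2(m)}` under Gamma-Gamma fading. -/
noncomputable def gammaGammaDensity (α β γb₂ x : ℝ) : ℝ :=
  if 0 < x then
    (α * β) ^ ((α + β) / 2) * x ^ ((α + β) / 4 - 1) /
        (Real.Gamma α * Real.Gamma β * γb₂ ^ ((α + β) / 4)) *
      besselK (α - β) (2 * √(α * β * √(x / γb₂)))
  else 0

/-- The measure on `ℝ` with Lebesgue density `f` (a nonnegative function). -/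
noncomputable def lawOfDensity (f : ℝ → ℝ) : Measure ℝ :=
  volume.withDensity (fun x => ENNReal.ofReal (f x))

/-- IQ imbalance coefficient `ω₁ = (1 + ζ e^{-jθ}) / 2`. -/
noncomputable def iqOmega₁ (ζ θ : ℝ) : ℂ :=
  (1 + (ζ : ℂ) * Complex.exp (-(Complex.I * (θ : ℂ)))) / 2

/-- IQ imbalance coefficient `ω₂ = (1 - ζ e^{jθ}) / 2`. -/
noncomputable def iqOmega₂ (ζ θ : ℝ) : ℂ :=
  (1 - (ζ : ℂ) * Complex.exp (Complex.I * (θ : ℂ))) / 2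

/-- Image-leakage ratio: power of the mirror signal relative to the direct signal. It vanishes
for an ideal destination (`ζ = 1`, `θ = 0`). -/
noncomputable def imageLeakageRatio (ζ θ : ℝ) : ℝ :=
  (‖iqOmega₂ ζ θ‖ / ‖iqOmega₁ ζ θ‖) ^ 2

/-- Relay gain `G = √(σ² / (E|h|² P₁ + σ₀²))`; `Eh2` stands for `E|h|²`. -/
noncomputable def relayGain (σ σ₀ P₁ Eh2 : ℝ) : ℝ :=
  √(σ ^ 2 / (Eh2 * P₁ + σ₀ ^ 2))

/-- `κ = 1 + σ_d² / (δ² G² σ₀²)`. -/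
noncomputable def relayKappa (δ σd G σ₀ : ℝ) : ℝ :=
  1 + σd ^ 2 / (δ ^ 2 * G ^ 2 * σ₀ ^ 2)

/-- `τ = (1 + ILR) κ γ₂ + (1 + ILR) (E[γ₁] + κ)`, with `e₁ = E[γ₁]` and `y = γ₂`. -/
noncomputable def sndrTau (ILR κ e₁ y : ℝ) : ℝ :=
  (1 + ILR) * κ * y + (1 + ILR) * (e₁ + κ)

/-- End-to-end signal-to-noise-plus-distortion ratio
`γ₁ γ₂ / (ILR γ₁ γ₂ + (1 + ILR) κ γ₂ + (1 + ILR) (E[γ₁] + κ))`,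
with `e₁ = E[γ₁]`, `x = γ₁` and `y = γ₂`. -/
noncomputable def sndr (ILR κ e₁ x y : ℝ) : ℝ :=
  x * y / (ILR * x * y + (1 + ILR) * κ * y + (1 + ILR) * (e₁ + κ))

/-! Put `X = γ₁γ₂/τ`. Dividing by `τ` gives `γ_e2e = X/(ILR·X + 1)`, so the capacity bound is
Jensen's inequality for the concave function `log (1 + x/(a x + 1))`
(`integral_log_one_add_div_le`).

Since `τ = (1 + ILR) κ (γ₂ + b)` with `b = (E[γ₁] + κ)/κ`, independence splits `J` into `E[γ₁]`
times `E[γ₂/(γ₂ + b)]`, up to a constant. The first factor is a sum of exponential moments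
(`rayleighPRS_mean`).

For the second, a Gamma-Gamma variable is `γb₂ (UV/(αβ))²` with `U`, `V` independent Gamma variables
(`lawOfDensity_gammaGammaDensity`), so its moments are products of Gamma functions. With `W`
standard exponential and independent, `y/(y + b) = E[exp(-(b/y) W)]`. Mellin inversion of `exp(-T)`
at `T = bW/γ₂`, followed by Fubini, gives a line integral of `Γ(w) Γ(1-w) Γ(α+2w) Γ(β+2w)` times a
power. Legendre duplication and the substitution `s = -w - (α+β)/4` turn it into the Meijer
function. -/

/-! ### Gamma laws in logarithmic coordinates -/

theorem lintegral_Ioi_zero_eq_lintegral_exp (g : ℝ → ENNReal) :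
    ∫⁻ x in Set.Ioi (0 : ℝ), g x = ∫⁻ p, ENNReal.ofReal (Real.exp p) * g (Real.exp p) := by
  have h := lintegral_image_eq_lintegral_abs_deriv_mul (s := Set.univ) (f := Real.exp)
    (f' := Real.exp) MeasurableSet.univ
    (fun x _ => (Real.hasDerivAt_exp x).hasDerivWithinAt) Real.exp_injective.injOn g
  rw [Set.image_univ, Real.range_exp] at h
  simpa [abs_of_pos (Real.exp_pos _)] using h

theorem lintegral_gammaMeasure_eq_lintegral_exp {a : ℝ} {g : ℝ → ENNReal} (hg : Measurable g) :
    ∫⁻ x, g x ∂gammaMeasure a 1 =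
      ∫⁻ p, ENNReal.ofReal (Real.exp (a * p - Real.exp p) / Real.Gamma a) * g (Real.exp p) := by
  rw [gammaMeasure, lintegral_withDensity_eq_lintegral_mul _ (by exact (measurable_gammaPDFReal a 1).ennreal_ofReal) hg]
  rw [← lintegral_add_compl _ (measurableSet_Ici (a := (0 : ℝ))), Set.compl_Ici]
  have h0 : ∫⁻ x in Set.Iio (0 : ℝ), (gammaPDF a 1 * g) x = 0 := by
    rw [setLIntegral_congr_fun (g := fun _ => 0) measurableSet_Iio]
    · simp
    · intro x hx
      simp [gammaPDF_of_neg hx]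
  rw [h0, add_zero, setLIntegral_congr Ioi_ae_eq_Ici.symm, lintegral_Ioi_zero_eq_lintegral_exp]
  refine lintegral_congr fun p => ?_
  rw [Pi.mul_apply, gammaPDF_of_nonneg (Real.exp_pos p).le, ← mul_assoc,
    ← ENNReal.ofReal_mul (Real.exp_pos p).le]
  congr 2
  rw [← Real.exp_mul, Real.one_rpow, one_mul, div_mul_eq_mul_div, one_mul, div_mul_eq_mul_div, mul_div_assoc',
    ← Real.exp_add, ← Real.exp_add]
  congr 2
  ring

/-! ### The Bessel function as an integral over the whole line -/

theorem sq_div_four_le_cosh (t : ℝ) : t ^ 2 / 4 ≤ Real.cosh t := by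
  rw [← Real.cosh_abs, Real.cosh_eq, ← sq_abs]
  have h := Real.quadratic_le_exp_of_nonneg (abs_nonneg t)
  have := Real.exp_pos (-|t|)
  linarith [abs_nonneg t]

theorem integrable_exp_mul_sub_mul_cosh (ν : ℝ) {x : ℝ} (hx : 0 < x) :
    Integrable fun t : ℝ => Real.exp (ν * t - x * Real.cosh t) := by
  have hq := (integrable_cexp_quadratic (b := ((x / 4 : ℝ) : ℂ)) (by simpa using hx) ν 0).norm
  refine hq.mono' (by fun_prop) (ae_of_all _ fun t => ?_)
  rw [Complex.norm_exp, Real.norm_of_nonneg (Real.exp_pos _).le, Real.exp_le_exp]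
  have h : (-((x / 4 : ℝ) : ℂ) * (t : ℂ) ^ 2 + ν * t + 0).re = -(x / 4) * t ^ 2 + ν * t := by
    rw [add_zero]; norm_cast
  rw [h]
  nlinarith [mul_le_mul_of_nonneg_left (sq_div_four_le_cosh t) hx.le]

/-- The odd part of `exp (ν t)` integrates to zero against an even weight. This two-sided form is
the one that convolutions produce. -/
theorem integral_exp_mul_sub_mul_cosh (ν : ℝ) {x : ℝ} (hx : 0 < x) :
    ∫ t : ℝ, Real.exp (ν * t - x * Real.cosh t) = 2 * besselK ν x := by
  have hi := integrable_exp_mul_sub_mul_cosh ν hx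
  have hn : Integrable fun t : ℝ => Real.exp (-(ν * t) - x * Real.cosh t) := by
    simpa using hi.comp_neg
  have he : ∫ t : ℝ, Real.exp (-(ν * t) - x * Real.cosh t) =
      ∫ t : ℝ, Real.exp (ν * t - x * Real.cosh t) := by
    rw [← integral_neg_eq_self]
    simp
  have hs : ∫ t : ℝ, Real.exp (-x * Real.cosh t) * Real.cosh (ν * t) =
      ∫ t : ℝ, Real.exp (ν * t - x * Real.cosh t) := by
    have hd : ∀ t : ℝ, Real.exp (-x * Real.cosh t) * Real.cosh (ν * t) =
        (1 / 2) * (Real.exp (ν * t - x * Real.cosh t) +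
          Real.exp (-(ν * t) - x * Real.cosh t)) := by
      intro t
      rw [Real.cosh_eq (ν * t), sub_eq_neg_add, sub_eq_neg_add, Real.exp_add, Real.exp_add,
        neg_mul]
      ring
    simp_rw [hd]
    rw [integral_const_mul, integral_add hi hn, he]
    ring
  rw [← hs, besselK, ← integral_comp_abs]
  refine integral_congr_ae (ae_of_all _ fun t => ?_)
  simp only [Real.cosh_abs]
  rcases abs_cases t with h | h <;> simp [h.1]

theorem besselK_nonneg (ν x : ℝ) : 0 ≤ besselK ν x :=
  integral_nonneg fun _ => mul_nonneg (Real.exp_pos _).le (Real.cosh_pos _).le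

theorem measurable_besselK (ν : ℝ) : Measurable (besselK ν) := by
  refine StronglyMeasurable.measurable ?_
  refine StronglyMeasurable.integral_prod_right (f := fun x t => Real.exp (-x * Real.cosh t) * Real.cosh (ν * t)) ?_
  refine Continuous.stronglyMeasurable ?_
  fun_prop

theorem measurable_gammaGammaDensity (α β γb₂ : ℝ) : Measurable (gammaGammaDensity α β γb₂) := by
  unfold gammaGammaDensity
  refine Measurable.ite measurableSet_Ioi ?_ measurable_const
  refine Measurable.mul (by fun_prop) ((measurable_besselK _).comp (by fun_prop))

/-! ### The Gamma-Gamma law as the law of a squared product of Gamma variables -/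

/-- In logarithmic coordinates a product of independent variables is a sum, so this convolution is
the density of `log (UV)` at `q`. -/
theorem lintegral_exp_conv_exp {α β : ℝ} (hα : 0 < α) (hβ : 0 < β) (q : ℝ) :
    ∫⁻ p, ENNReal.ofReal (Real.exp (α * p - Real.exp p) / Real.Gamma α) *
        ENNReal.ofReal (Real.exp (β * (q - p) - Real.exp (q - p)) / Real.Gamma β) =
      ENNReal.ofReal (Real.exp ((α + β) / 2 * q) / (Real.Gamma α * Real.Gamma β) *
        (2 * besselK (α - β) (2 * Real.exp (q / 2)))) := by
  have h1 := Real.Gamma_pos_of_pos hα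
  have h2 := Real.Gamma_pos_of_pos hβ
  -- Centring at `q / 2` is what makes `exp p + exp (q - p)` equal to `2 exp (q/2) cosh t`.
  rw [← lintegral_add_right_eq_self _ (q / 2)]
  have hf : ∀ t : ℝ, ENNReal.ofReal (Real.exp (α * (t + q / 2) - Real.exp (t + q / 2)) /
        Real.Gamma α) * ENNReal.ofReal (Real.exp (β * (q - (t + q / 2)) -
          Real.exp (q - (t + q / 2))) / Real.Gamma β) =
      ENNReal.ofReal (Real.exp ((α + β) / 2 * q) / (Real.Gamma α * Real.Gamma β) *
        Real.exp ((α - β) * t - 2 * Real.exp (q / 2) * Real.cosh t)) := by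
    intro t
    rw [← ENNReal.ofReal_mul (by positivity), div_mul_div_comm, ← Real.exp_add,
      div_mul_eq_mul_div, ← Real.exp_add]
    congr 3
    rw [show q - (t + q / 2) = -t + q / 2 by ring, Real.exp_add, Real.exp_add, Real.cosh_eq]
    ring
  simp_rw [hf]
  rw [← ofReal_integral_eq_lintegral_ofReal, integral_const_mul,
    integral_exp_mul_sub_mul_cosh _ (by positivity)]
  · exact (integrable_exp_mul_sub_mul_cosh _ (by positivity)).const_mul _
  · exact ae_of_all _ fun _ => by positivity

/-- The SNR is `x = γb₂ (exp q/(αβ))²` when `q = log (UV)`, and `dx/dq = 2x`; the pulled-back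
density is thus the convolution above. -/
theorem gammaGammaDensity_exp {α β γb₂ : ℝ} (hα : 0 < α) (hβ : 0 < β) (hγb₂ : 0 < γb₂) (q : ℝ) :
    2 * (γb₂ * (Real.exp q / (α * β)) ^ 2) *
        gammaGammaDensity α β γb₂ (γb₂ * (Real.exp q / (α * β)) ^ 2) =
      Real.exp ((α + β) / 2 * q) / (Real.Gamma α * Real.Gamma β) *
        (2 * besselK (α - β) (2 * Real.exp (q / 2))) := by
  have h1 := Real.Gamma_pos_of_pos hα
  have h2 := Real.Gamma_pos_of_pos hβ
  have hu : 0 < Real.exp q / (α * β) := by positivity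
  have hx : 0 < γb₂ * (Real.exp q / (α * β)) ^ 2 := by positivity
  rw [gammaGammaDensity, if_pos hx, mul_div_cancel_left₀ _ hγb₂.ne', Real.sqrt_sq hu.le,
    mul_div_cancel₀ _ (by positivity), Real.sqrt_eq_rpow (Real.exp q), ← Real.exp_mul,
    mul_one_div, Real.rpow_sub_one hx.ne', Real.mul_rpow hγb₂.le (by positivity),
    ← Real.rpow_natCast, ← Real.rpow_mul hu.le,
    show ((2 : ℕ) : ℝ) * ((α + β) / 4) = (α + β) / 2 by push_cast; ring,
    Real.div_rpow (z := (α + β) / 2) (Real.exp_pos q).le (by positivity), ← Real.exp_mul,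
    mul_comm q]
  have h3 : 0 < (α * β) ^ ((α + β) / 2) := by positivity
  have h4 : 0 < γb₂ ^ ((α + β) / 4) := by positivity
  field_simp

theorem lawOfDensity_gammaGammaDensity {α β γb₂ : ℝ} (hα : 0 < α) (hβ : 0 < β)
    (hγb₂ : 0 < γb₂) :
    lawOfDensity (gammaGammaDensity α β γb₂) =
      ((gammaMeasure α 1).prod (gammaMeasure β 1)).map
        (fun z => γb₂ * (z.1 * z.2 / (α * β)) ^ 2) := by
  have := isProbabilityMeasure_gammaMeasure hα one_pos
  have := isProbabilityMeasure_gammaMeasure hβ one_pos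
  have hdm : Measurable fun x => ENNReal.ofReal (gammaGammaDensity α β γb₂ x) :=
    (measurable_gammaGammaDensity α β γb₂).ennreal_ofReal
  refine Measure.ext_of_lintegral _ fun g hg => ?_
  set k : ℝ → ℝ := fun q => γb₂ * (Real.exp q / (α * β)) ^ 2 with hk
  have hkm : Measurable k := by fun_prop
  have hki : Set.range k = Set.Ioi 0 := by
    ext x
    constructor
    · rintro ⟨q, rfl⟩
      exact Set.mem_Ioi.2 (by simp only [hk]; positivity)
    · intro hx
      have hx' : 0 < x := hx
      refine ⟨Real.log (α * β * √(x / γb₂)), ?_⟩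
      simp only [hk]
      rw [Real.exp_log (by positivity), mul_div_cancel_left₀ _ (by positivity),
        Real.sq_sqrt (by positivity)]
      field_simp
  have hkinj : Function.Injective k := by
    intro p q hpq
    have h := mul_left_cancel₀ hγb₂.ne' hpq
    have h' := (pow_left_inj₀ (by positivity) (by positivity) two_ne_zero).1 h
    exact Real.exp_injective ((div_left_inj' (by positivity)).1 h')
  have hkd : ∀ q, HasDerivAt k (2 * k q) q := by
    intro q
    have := (((Real.hasDerivAt_exp q).div_const (α * β)).pow 2).const_mul γb₂
    refine this.congr_deriv ?_
    simp only [hk]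
    push_cast
    ring
  have hL : ∫⁻ x, g x ∂lawOfDensity (gammaGammaDensity α β γb₂) =
      ∫⁻ q, ENNReal.ofReal (Real.exp ((α + β) / 2 * q) / (Real.Gamma α * Real.Gamma β) *
        (2 * besselK (α - β) (2 * Real.exp (q / 2)))) * g (k q) := by
    rw [lawOfDensity, lintegral_withDensity_eq_lintegral_mul _ hdm hg,
      ← lintegral_add_compl _ (measurableSet_Ioi (a := (0 : ℝ))), Set.compl_Ioi]
    have h0 : ∫⁻ x in Set.Iic (0 : ℝ),
        ((fun x => ENNReal.ofReal (gammaGammaDensity α β γb₂ x)) * g) x = 0 := by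
      rw [setLIntegral_congr_fun (g := fun _ => 0) measurableSet_Iic]
      · simp
      · intro x hx
        simp [gammaGammaDensity, not_lt.2 (Set.mem_Iic.1 hx)]
    rw [h0, add_zero, ← hki, ← Set.image_univ, lintegral_image_eq_lintegral_abs_deriv_mul
      MeasurableSet.univ (fun q _ => (hkd q).hasDerivWithinAt) hkinj.injOn, Measure.restrict_univ]
    refine lintegral_congr fun q => ?_
    have hkq : 0 < 2 * k q := by simp only [hk]; positivity
    rw [Pi.mul_apply, ← mul_assoc, ← ENNReal.ofReal_mul (abs_nonneg _), abs_of_pos hkq,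
      gammaGammaDensity_exp hα hβ hγb₂]
  rw [hL, lintegral_map hg (by fun_prop), lintegral_prod _ (by fun_prop)]
  simp_rw [← lintegral_exp_conv_exp hα hβ]
  have hgm : Measurable fun x => ∫⁻ y, g (γb₂ * (x * y / (α * β)) ^ 2) ∂gammaMeasure β 1 :=
    Measurable.lintegral_prod_right'
      (f := fun z : ℝ × ℝ => g (γb₂ * (z.1 * z.2 / (α * β)) ^ 2)) (by fun_prop)
  rw [lintegral_gammaMeasure_eq_lintegral_exp hgm]
  have hR : ∀ p, ∫⁻ y, g (γb₂ * (Real.exp p * y / (α * β)) ^ 2) ∂gammaMeasure β 1 =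
      ∫⁻ q, ENNReal.ofReal (Real.exp (β * (q - p) - Real.exp (q - p)) / Real.Gamma β) *
        g (k q) := by
    intro p
    -- Translation by `p` replaces `log V` by `q = log U + log V`, so that `g` depends on `q` alone
    -- and Tonelli applies.
    rw [lintegral_gammaMeasure_eq_lintegral_exp (by fun_prop),
      ← lintegral_sub_right_eq_self _ p]
    refine lintegral_congr fun q => ?_
    simp only [hk, ← Real.exp_add, add_sub_cancel]
  simp_rw [hR]
  have hl : ∀ q, (∫⁻ p, ENNReal.ofReal (Real.exp (α * p - Real.exp p) / Real.Gamma α) *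
        ENNReal.ofReal (Real.exp (β * (q - p) - Real.exp (q - p)) / Real.Gamma β)) * g (k q) =
      ∫⁻ p, ENNReal.ofReal (Real.exp (α * p - Real.exp p) / Real.Gamma α) *
        (ENNReal.ofReal (Real.exp (β * (q - p) - Real.exp (q - p)) / Real.Gamma β) *
          g (k q)) := by
    intro q
    rw [← lintegral_mul_const _ (by fun_prop)]
    simp_rw [mul_assoc]
  have hr : ∀ p, ENNReal.ofReal (Real.exp (α * p - Real.exp p) / Real.Gamma α) *
      (∫⁻ q, ENNReal.ofReal (Real.exp (β * (q - p) - Real.exp (q - p)) / Real.Gamma β) *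
        g (k q)) = ∫⁻ q, ENNReal.ofReal (Real.exp (α * p - Real.exp p) / Real.Gamma α) *
        (ENNReal.ofReal (Real.exp (β * (q - p) - Real.exp (q - p)) / Real.Gamma β) *
          g (k q)) := by
    intro p
    rw [← lintegral_const_mul _ (by fun_prop)]
  simp_rw [hl, hr]
  exact lintegral_lintegral_swap (by fun_prop)

/-! ### Moments and Laplace transform of Gamma laws -/

theorem integral_gammaMeasure {E : Type*} [NormedAddCommGroup E] [NormedSpace ℝ E] {a : ℝ}
    (ha : 0 < a) (g : ℝ → E) :
    ∫ x, g x ∂gammaMeasure a 1 =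
      ∫ x in Set.Ioi (0 : ℝ), (x ^ (a - 1) * Real.exp (-x) / Real.Gamma a) • g x := by
  have hm : Measurable (gammaPDF a 1) := (measurable_gammaPDFReal a 1).ennreal_ofReal
  rw [gammaMeasure, integral_withDensity_eq_integral_toReal_smul hm
    (ae_of_all _ fun x => ENNReal.ofReal_lt_top), ← integral_indicator measurableSet_Ioi]
  refine integral_congr_ae ?_
  filter_upwards [Measure.ae_ne volume (0 : ℝ)] with x hx
  rcases lt_or_gt_of_ne hx with h | h
  · simp [gammaPDF_of_neg h, h.le]
  · have := Real.Gamma_pos_of_pos ha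
    rw [Set.indicator_of_mem (Set.mem_Ioi.2 h), gammaPDF_of_nonneg h.le,
      ENNReal.toReal_ofReal (by positivity)]
    congr 1
    rw [Real.one_rpow, one_mul]
    ring

theorem ae_pos_gammaMeasure (a : ℝ) : ∀ᵐ x ∂gammaMeasure a 1, 0 < x := by
  have hm : Measurable (gammaPDF a 1) := (measurable_gammaPDFReal a 1).ennreal_ofReal
  rw [gammaMeasure, ae_withDensity_iff hm]
  filter_upwards [Measure.ae_ne volume (0 : ℝ)] with x hx h
  by_contra h'
  exact h (gammaPDF_of_neg (lt_of_le_of_ne (not_lt.1 h') hx))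

theorem integral_cpow_gammaMeasure {a : ℝ} (ha : 0 < a) {w : ℂ} (hw : 0 < a + w.re) :
    ∫ x, (x : ℂ) ^ w ∂gammaMeasure a 1 = Complex.Gamma (a + w) / Complex.Gamma a := by
  rw [integral_gammaMeasure ha, Complex.Gamma_eq_integral (by simpa using hw),
    Complex.GammaIntegral, Complex.Gamma_ofReal, ← integral_div]
  refine setIntegral_congr_fun measurableSet_Ioi fun x hx => ?_
  have hx0 : (x : ℂ) ≠ 0 := by exact_mod_cast (Set.mem_Ioi.1 hx).ne'
  rw [Complex.real_smul]
  push_cast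
  rw [Complex.ofReal_cpow (Set.mem_Ioi.1 hx).le, show (a : ℂ) + w - 1 = (a - 1) + w by ring,
    Complex.cpow_add _ _ hx0]
  push_cast
  ring

theorem integrable_rpow_gammaMeasure {a : ℝ} (ha : 0 < a) {w : ℝ} (hw : 0 < a + w) :
    Integrable (fun x => x ^ w) (gammaMeasure a 1) := by
  -- A non-integrable function has Bochner integral `0` by convention, so a nonzero value proves
  -- integrability.
  refine Integrable.of_integral_ne_zero ?_
  have h := integral_gammaMeasure ha fun x : ℝ => x ^ w
  have h' := Real.Gamma_eq_integral hw
  have e : ∫ x in Set.Ioi (0 : ℝ), (x ^ (a - 1) * Real.exp (-x) / Real.Gamma a) • x ^ w =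
      Real.Gamma (a + w) / Real.Gamma a := by
    rw [h', ← integral_div]
    refine setIntegral_congr_fun measurableSet_Ioi fun x hx => ?_
    simp only [smul_eq_mul]
    rw [show a + w - 1 = (a - 1) + w by ring, Real.rpow_add hx]
    ring
  rw [h, e]
  exact (div_pos (Real.Gamma_pos_of_pos hw) (Real.Gamma_pos_of_pos ha)).ne'

theorem integral_exp_neg_mul_gammaMeasure_one {t : ℝ} (ht : 0 ≤ t) :
    ∫ v, Real.exp (-(t * v)) ∂gammaMeasure 1 1 = 1 / (1 + t) := by
  rw [integral_gammaMeasure one_pos]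
  have h := integral_exp_mul_Ioi (a := -(1 + t)) (by linarith) 0
  have e : ∀ x : ℝ, (x ^ ((1 : ℝ) - 1) * Real.exp (-x) / Real.Gamma 1) • Real.exp (-(t * x)) =
      Real.exp (-(1 + t) * x) := by
    intro x
    rw [sub_self, Real.rpow_zero, Real.Gamma_one, smul_eq_mul, one_mul, div_one, ← Real.exp_add]
    ring_nf
  simp_rw [e]
  rw [h]
  have : 1 + t ≠ 0 := by positivity
  rw [mul_zero, Real.exp_zero]
  field_simp

/-! ### Mellin inversion of the exponential -/

theorem norm_Gamma_le_Gamma_re {s : ℂ} (hs : 0 < s.re) :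
    ‖Complex.Gamma s‖ ≤ Real.Gamma s.re := by
  rw [Complex.Gamma_eq_integral hs, Real.Gamma_eq_integral hs, Complex.GammaIntegral]
  refine (norm_integral_le_integral_norm _).trans_eq ?_
  refine setIntegral_congr_fun measurableSet_Ioi fun x hx => ?_
  rw [norm_mul, Complex.norm_cpow_eq_rpow_re_of_pos hx, Complex.norm_real,
    Real.norm_of_nonneg (Real.exp_pos _).le]
  simp

/-- From `Γ(s + 2) = (s + 1) s Γ(s)`, with the left side bounded on the line, `Γ(s)` decays like
`|s|⁻²`; no Stirling estimate is needed. -/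
theorem integrable_Gamma_vertical {σ : ℝ} (hσ : 0 < σ) :
    Integrable fun y : ℝ => Complex.Gamma (σ + y * Complex.I) := by
  have hre : ∀ y : ℝ, ((σ : ℂ) + y * Complex.I).re = σ := fun y => by simp
  have hc : Continuous fun y : ℝ => Complex.Gamma (σ + y * Complex.I) := by
    refine continuous_iff_continuousAt.2 fun y => ?_
    refine ContinuousAt.comp (g := Complex.Gamma) (f := fun y : ℝ => (σ : ℂ) + y * Complex.I)
      ?_ (by fun_prop)
    refine (Complex.differentiableAt_Gamma _ fun n h => ?_).continuousAt
    have := congrArg Complex.re h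
    rw [hre] at this
    simp at this
    linarith [(Nat.cast_nonneg n : (0 : ℝ) ≤ n)]
  have hb : Integrable fun y : ℝ => (min (σ ^ 2) 1)⁻¹ * Real.Gamma (σ + 2) * (1 + y ^ 2)⁻¹ :=
    integrable_inv_one_add_sq.const_mul _
  refine hb.mono' hc.aestronglyMeasurable (ae_of_all _ fun y => ?_)
  set s : ℂ := (σ : ℂ) + y * Complex.I with hs
  have hs0 : s ≠ 0 := fun h => by
    have := congrArg Complex.re h
    rw [hre] at this
    simp at this
    linarith
  have hs1 : s + 1 ≠ 0 := fun h => by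
    have := congrArg Complex.re h
    rw [Complex.add_re, hre] at this
    simp at this
    linarith
  have hG : Complex.Gamma (s + 2) = (s + 1) * (s * Complex.Gamma s) := by
    rw [← Complex.Gamma_add_one s hs0, ← Complex.Gamma_add_one _ hs1]
    ring_nf
  have hle : ‖Complex.Gamma (s + 2)‖ ≤ Real.Gamma (σ + 2) := by
    have h := norm_Gamma_le_Gamma_re (s := s + 2) (by rw [Complex.add_re, hre]; simp; linarith)
    rwa [Complex.add_re, hre, show (2 : ℂ).re = 2 from rfl] at h
  have hn : ‖s‖ ^ 2 = σ ^ 2 + y ^ 2 := by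
    rw [Complex.sq_norm, Complex.normSq_apply]
    simp [hs]
    ring
  have hn1 : ‖s‖ ≤ ‖s + 1‖ := by
    rw [← sq_le_sq₀ (norm_nonneg _) (norm_nonneg _), hn, Complex.sq_norm, Complex.normSq_apply]
    simp [hs]
    nlinarith
  have hmin : 0 < min (σ ^ 2) 1 := lt_min (by positivity) one_pos
  have hlow : min (σ ^ 2) 1 * (1 + y ^ 2) ≤ σ ^ 2 + y ^ 2 := by
    nlinarith [min_le_left (σ ^ 2) 1, min_le_right (σ ^ 2) 1, sq_nonneg y]
  have hkey : (σ ^ 2 + y ^ 2) * ‖Complex.Gamma s‖ ≤ Real.Gamma (σ + 2) := by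
    refine le_trans ?_ hle
    rw [hG, norm_mul, norm_mul, ← hn, ← mul_assoc, sq]
    gcongr
  rw [mul_assoc, mul_comm, mul_assoc, ← mul_inv, ← div_eq_mul_inv, le_div_iff₀ (by positivity)]
  calc ‖Complex.Gamma s‖ * ((1 + y ^ 2) * min (σ ^ 2) 1)
      = (min (σ ^ 2) 1 * (1 + y ^ 2)) * ‖Complex.Gamma s‖ := by ring
    _ ≤ (σ ^ 2 + y ^ 2) * ‖Complex.Gamma s‖ := by gcongr
    _ ≤ _ := hkey

theorem exp_neg_eq_integral_Gamma {σ : ℝ} (hσ : 0 < σ) {x : ℝ} (hx : 0 < x) :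
    (Real.exp (-x) : ℂ) = 1 / (2 * (Real.pi : ℂ)) *
      ∫ y : ℝ, (x : ℂ) ^ (-((σ : ℂ) + y * Complex.I)) * Complex.Gamma (σ + y * Complex.I) := by
  have hG : ∀ y : ℝ, mellin (fun x : ℝ => (Real.exp (-x) : ℂ)) (σ + y * Complex.I) =
      Complex.Gamma (σ + y * Complex.I) := fun y => by
    rw [← Complex.GammaIntegral_eq_mellin, Complex.Gamma_eq_integral (by simpa using hσ)]
  have hconv : MellinConvergent (fun x : ℝ => (Real.exp (-x) : ℂ)) (σ : ℂ) := by
    have := Complex.GammaIntegral_convergent (s := σ) (by simpa using hσ)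
    refine this.congr_fun (fun t _ => ?_) measurableSet_Ioi
    simp [mul_comm]
  have h := mellinInv_mellin_eq σ (fun x : ℝ => (Real.exp (-x) : ℂ)) hx hconv
    (by simpa only [Complex.VerticalIntegrable, hG] using integrable_Gamma_vertical hσ)
    (by fun_prop)
  rw [← h, mellinInv]
  simp_rw [hG, smul_eq_mul]
  rw [Complex.real_smul]
  push_cast
  rfl

/-- The Mellin-Barnes representation of the Laplace transform at `1` of a positive random
variable. -/
theorem integral_exp_neg_eq_integral_Gamma_mul {X : Type*} [MeasurableSpace X] {μ : Measure X}
    [IsProbabilityMeasure μ] {T : X → ℝ} (hTm : Measurable T) (hT : ∀ᵐ x ∂μ, 0 < T x) {σ : ℝ}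
    (hσ : 0 < σ) (hTi : Integrable (fun x => T x ^ (-σ)) μ) :
    ((∫ x, Real.exp (-T x) ∂μ : ℝ) : ℂ) = 1 / (2 * (Real.pi : ℂ)) *
      ∫ y : ℝ, Complex.Gamma (σ + y * Complex.I) *
        ∫ x, (T x : ℂ) ^ (-((σ : ℂ) + y * Complex.I)) ∂μ := by
  rw [← integral_complex_ofReal]
  have e : ∀ᵐ x ∂μ, (Real.exp (-T x) : ℂ) = 1 / (2 * (Real.pi : ℂ)) *
      ∫ y : ℝ, (T x : ℂ) ^ (-((σ : ℂ) + y * Complex.I)) * Complex.Gamma (σ + y * Complex.I) := by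
    filter_upwards [hT] with x hx using exp_neg_eq_integral_Gamma hσ hx
  rw [integral_congr_ae e, integral_const_mul]
  congr 1
  rw [integral_integral_swap]
  · refine integral_congr_ae (ae_of_all _ fun y => ?_)
    simp only
    rw [integral_mul_const, mul_comm]
  -- The norm of `T ^ (-s)` depends only on `Re s = σ`, so the double integrand is dominated by a
  -- product of integrable functions.
  · have hd := hTi.mul_prod (integrable_Gamma_vertical hσ).norm
    refine hd.mono ?_ ?_
    · refine AEStronglyMeasurable.mul ?_ ?_
      · refine Measurable.aestronglyMeasurable ?_
        fun_prop
      · exact (integrable_Gamma_vertical hσ).aestronglyMeasurable.comp_snd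
    · have hT' := Measure.quasiMeasurePreserving_fst (μ := μ) (ν := (volume : Measure ℝ)) |>.ae hT
      filter_upwards [hT'] with z hz
      simp only [Function.uncurry]
      rw [norm_mul, norm_mul, Complex.norm_cpow_eq_rpow_re_of_pos hz, norm_norm,
        Real.norm_of_nonneg (Real.rpow_nonneg hz.le _)]
      simp

/-! ### Mellin-Barnes integral for the Gamma-Gamma law -/

/-- With real logarithms, identities between complex powers of positive numbers become linear in the
exponents, without branch conditions. -/
theorem ofReal_cpow_eq_exp_log {x : ℝ} (hx : 0 < x) (w : ℂ) :
    (x : ℂ) ^ w = Complex.exp ((Real.log x : ℂ) * w) := by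
  rw [Complex.cpow_def_of_ne_zero (by exact_mod_cast hx.ne'), Complex.ofReal_log hx.le]

theorem gammaGamma_snr_pos {α β γb₂ x y : ℝ} (hα : 0 < α) (hβ : 0 < β) (hγb₂ : 0 < γb₂)
    (hx : 0 < x) (hy : 0 < y) : 0 < γb₂ * (x * y / (α * β)) ^ 2 := by
  positivity

theorem log_gammaGamma_snr {α β γb₂ x y : ℝ} (hα : 0 < α) (hβ : 0 < β) (hγb₂ : 0 < γb₂)
    (hx : 0 < x) (hy : 0 < y) :
    Real.log (γb₂ * (x * y / (α * β)) ^ 2) =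
      Real.log (γb₂ / (α * β) ^ 2) + 2 * Real.log x + 2 * Real.log y := by
  rw [show γb₂ * (x * y / (α * β)) ^ 2 = γb₂ / (α * β) ^ 2 * (x ^ 2 * y ^ 2) by field_simp,
    Real.log_mul (by positivity) (by positivity), Real.log_mul (by positivity) (by positivity),
    Real.log_pow, Real.log_pow]
  push_cast
  ring

theorem ae_pos_prod_gammaMeasure {α β : ℝ} (hα : 0 < α) (hβ : 0 < β) :
    ∀ᵐ z ∂(gammaMeasure α 1).prod (gammaMeasure β 1), 0 < z.1 ∧ 0 < z.2 := by
  have := isProbabilityMeasure_gammaMeasure hα one_pos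
  have := isProbabilityMeasure_gammaMeasure hβ one_pos
  exact (Measure.quasiMeasurePreserving_fst.ae (ae_pos_gammaMeasure α)).and
    (Measure.quasiMeasurePreserving_snd.ae (ae_pos_gammaMeasure β))

theorem integral_cpow_gammaGamma {α β γb₂ : ℝ} (hα : 0 < α) (hβ : 0 < β) (hγb₂ : 0 < γb₂)
    {w : ℂ} (hw : 0 < w.re) :
    ∫ y, (y : ℂ) ^ w ∂lawOfDensity (gammaGammaDensity α β γb₂) =
      ((γb₂ / (α * β) ^ 2 : ℝ) : ℂ) ^ w * (Complex.Gamma (α + 2 * w) / Complex.Gamma α *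
        (Complex.Gamma (β + 2 * w) / Complex.Gamma β)) := by
  have := isProbabilityMeasure_gammaMeasure hα one_pos
  have := isProbabilityMeasure_gammaMeasure hβ one_pos
  have h2 : (2 * w).re = 2 * w.re := by simp
  rw [lawOfDensity_gammaGammaDensity hα hβ hγb₂, integral_map (by fun_prop)
    (Measurable.aestronglyMeasurable (by fun_prop)),
    ← integral_cpow_gammaMeasure hα (w := 2 * w) (by rw [h2]; positivity),
    ← integral_cpow_gammaMeasure hβ (w := 2 * w) (by rw [h2]; positivity), ← integral_prod_mul,
    ← integral_const_mul]
  refine integral_congr_ae ?_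
  filter_upwards [ae_pos_prod_gammaMeasure hα hβ] with z hz
  rw [ofReal_cpow_eq_exp_log (gammaGamma_snr_pos hα hβ hγb₂ hz.1 hz.2),
    log_gammaGamma_snr hα hβ hγb₂ hz.1 hz.2, ofReal_cpow_eq_exp_log (by positivity),
    ofReal_cpow_eq_exp_log hz.1, ofReal_cpow_eq_exp_log hz.2, ← Complex.exp_add,
    ← Complex.exp_add]
  push_cast
  ring_nf

theorem integrable_rpow_gammaGamma {α β γb₂ : ℝ} (hα : 0 < α) (hβ : 0 < β) (hγb₂ : 0 < γb₂)
    {w : ℝ} (hw : 0 < w) :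
    Integrable (fun y => y ^ w) (lawOfDensity (gammaGammaDensity α β γb₂)) := by
  have := isProbabilityMeasure_gammaMeasure hα one_pos
  have := isProbabilityMeasure_gammaMeasure hβ one_pos
  rw [lawOfDensity_gammaGammaDensity hα hβ hγb₂, integrable_map_measure
    (Measurable.aestronglyMeasurable (by fun_prop)) (by fun_prop)]
  refine (((integrable_rpow_gammaMeasure hα (w := 2 * w) (by positivity)).mul_prod
    (integrable_rpow_gammaMeasure hβ (w := 2 * w) (by positivity))).const_mul
      ((γb₂ / (α * β) ^ 2) ^ w)).congr ?_
  filter_upwards [ae_pos_prod_gammaMeasure hα hβ] with z hz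
  rw [Function.comp, Real.rpow_def_of_pos (gammaGamma_snr_pos hα hβ hγb₂ hz.1 hz.2),
    log_gammaGamma_snr hα hβ hγb₂ hz.1 hz.2, Real.rpow_def_of_pos (by positivity),
    Real.rpow_def_of_pos hz.1, Real.rpow_def_of_pos hz.2, ← Real.exp_add, ← Real.exp_add]
  ring_nf

theorem ae_pos_gammaGamma {α β γb₂ : ℝ} (hα : 0 < α) (hβ : 0 < β) (hγb₂ : 0 < γb₂) :
    ∀ᵐ y ∂lawOfDensity (gammaGammaDensity α β γb₂), 0 < y := by
  rw [lawOfDensity_gammaGammaDensity hα hβ hγb₂]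
  refine (ae_map_iff (by fun_prop) measurableSet_Ioi).2 ?_
  filter_upwards [ae_pos_prod_gammaMeasure hα hβ] with z hz using
    gammaGamma_snr_pos hα hβ hγb₂ hz.1 hz.2

/-- Mellin-Barnes representation of the mean of `γ / (γ + b)` for a Gamma-Gamma SNR `γ`. -/
theorem integral_div_add_gammaGamma {α β γb₂ b σ : ℝ} (hα : 0 < α) (hβ : 0 < β)
    (hγb₂ : 0 < γb₂) (hb : 0 < b) (hσ : 0 < σ) (hσ1 : σ < 1) :
    ((∫ y, y / (y + b) ∂lawOfDensity (gammaGammaDensity α β γb₂) : ℝ) : ℂ) =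
      1 / (2 * (Real.pi : ℂ) * (Complex.Gamma α * Complex.Gamma β)) *
      ∫ y : ℝ, (fun w : ℂ => Complex.Gamma w * Complex.Gamma (1 - w) *
        (Complex.Gamma (α + 2 * w) * Complex.Gamma (β + 2 * w)) *
        ((γb₂ / ((α * β) ^ 2 * b) : ℝ) : ℂ) ^ w) (σ + y * Complex.I) := by
  have := isProbabilityMeasure_gammaMeasure hα one_pos
  have := isProbabilityMeasure_gammaMeasure hβ one_pos
  have := isProbabilityMeasure_gammaMeasure one_pos one_pos
  set ν := lawOfDensity (gammaGammaDensity α β γb₂) with hν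
  have hνp : IsProbabilityMeasure ν := by
    rw [hν, lawOfDensity_gammaGammaDensity hα hβ hγb₂]
    exact Measure.isProbabilityMeasure_map (by fun_prop)
  -- The second coordinate is the auxiliary exponential variable, whose Laplace transform at `b / y`
  -- is `y / (y + b)`. Its moment of order `-σ` is finite because `σ < 1`.
  set μ := ν.prod (gammaMeasure 1 1) with hμ
  have hpos : ∀ᵐ z ∂μ, 0 < z.1 ∧ 0 < z.2 :=
    (Measure.quasiMeasurePreserving_fst.ae (ae_pos_gammaGamma hα hβ hγb₂)).and
      (Measure.quasiMeasurePreserving_snd.ae (ae_pos_gammaMeasure 1))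
  have hlog : ∀ z : ℝ × ℝ, 0 < z.1 → 0 < z.2 →
      Real.log (b / z.1 * z.2) = Real.log b - Real.log z.1 + Real.log z.2 := fun z h1 h2 => by
    rw [Real.log_mul (by positivity) (by positivity), Real.log_div hb.ne' h1.ne']
  have hT : ∀ᵐ z ∂μ, 0 < b / z.1 * z.2 := by
    filter_upwards [hpos] with z hz
    have := hz.1
    have := hz.2
    positivity
  have hTm : Measurable fun z : ℝ × ℝ => b / z.1 * z.2 := by fun_prop
  have hTi : Integrable (fun z : ℝ × ℝ => (b / z.1 * z.2) ^ (-σ)) μ := by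
    refine (((integrable_rpow_gammaGamma hα hβ hγb₂ hσ).mul_prod
      (integrable_rpow_gammaMeasure one_pos (w := -σ) (by linarith))).const_mul
        (b ^ (-σ))).congr ?_
    filter_upwards [hpos, hT] with z hz hz'
    rw [Real.rpow_def_of_pos hz', hlog z hz.1 hz.2, Real.rpow_def_of_pos hb,
      Real.rpow_def_of_pos hz.1, Real.rpow_def_of_pos hz.2, ← Real.exp_add, ← Real.exp_add]
    ring_nf
  have hLap : ∫ z, Real.exp (-(b / z.1 * z.2)) ∂μ = ∫ y, y / (y + b) ∂ν := by
    rw [hμ, integral_prod]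
    · refine integral_congr_ae ?_
      filter_upwards [ae_pos_gammaGamma hα hβ hγb₂] with y hy
      rw [integral_exp_neg_mul_gammaMeasure_one (by positivity)]
      field_simp
    · refine Integrable.mono' (integrable_const 1)
        (Measurable.aestronglyMeasurable (by fun_prop)) ?_
      filter_upwards [hT] with z hz
      rw [Real.norm_of_nonneg (Real.exp_pos _).le]
      exact Real.exp_le_one_iff.2 (by linarith)
  rw [← hLap, integral_exp_neg_eq_integral_Gamma_mul hTm hT hσ hTi, ← integral_const_mul,
    ← integral_const_mul]
  refine integral_congr_ae (ae_of_all _ fun y => ?_)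
  simp only
  set w : ℂ := (σ : ℂ) + y * Complex.I with hw
  have hwre : w.re = σ := by simp [hw]
  have hM : ∫ z, ((b / z.1 * z.2 : ℝ) : ℂ) ^ (-w) ∂μ =
      (b : ℂ) ^ (-w) * ((∫ y, (y : ℂ) ^ w ∂ν) * ∫ v, (v : ℂ) ^ (-w) ∂gammaMeasure 1 1) := by
    rw [← integral_prod_mul, ← integral_const_mul]
    refine integral_congr_ae ?_
    filter_upwards [hpos, hT] with z hz hz'
    rw [ofReal_cpow_eq_exp_log hz', hlog z hz.1 hz.2, ofReal_cpow_eq_exp_log hb,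
      ofReal_cpow_eq_exp_log hz.1, ofReal_cpow_eq_exp_log hz.2, ← Complex.exp_add,
      ← Complex.exp_add]
    push_cast
    ring_nf
  have hr : ((γb₂ / ((α * β) ^ 2 * b) : ℝ) : ℂ) ^ w =
      (b : ℂ) ^ (-w) * ((γb₂ / (α * β) ^ 2 : ℝ) : ℂ) ^ w := by
    rw [← div_div, ofReal_cpow_eq_exp_log (by positivity), Real.log_div (by positivity) hb.ne',
      ofReal_cpow_eq_exp_log hb, ofReal_cpow_eq_exp_log (by positivity), ← Complex.exp_add]
    push_cast
    ring_nf
  rw [hM, integral_cpow_gammaGamma hα hβ hγb₂ (by rw [hwre]; exact hσ),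
    integral_cpow_gammaMeasure one_pos (by rw [Complex.neg_re, hwre]; linarith), hr,
    Complex.ofReal_one, Complex.Gamma_one, div_one, ← sub_eq_add_neg]
  field_simp

/-! ### From the Mellin-Barnes integral to the Meijer function -/

theorem Gamma_mul_Gamma_half_shift (a w : ℂ) :
    Complex.Gamma (a / 2 + w) * Complex.Gamma (a / 2 + 1 / 2 + w) =
      Complex.Gamma (a + 2 * w) * (2 ^ (1 - a) * 2 ^ (-(2 * w))) * (√Real.pi : ℂ) := by
  have h := Complex.Gamma_mul_Gamma_add_half (a / 2 + w)
  rw [← Complex.cpow_add _ _ two_ne_zero]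
  convert h using 2
  · ring_nf
  · ring_nf

/-- The Mellin-Barnes integrand for the Gamma-Gamma capacity bound, in the variable
`w = -s - (α + β) / 4` and with the duplication formula applied. -/
theorem meijerGIntegrand_gammaGamma {α β r : ℝ} (hr : 0 < r) (w : ℂ) :
    meijerGIntegrand 5 1 ![(-((α : ℂ) + β) / 4)]
        ![((α : ℂ) - β) / 4, ((α : ℂ) - β + 2) / 4, ((β : ℂ) - α) / 4, ((β : ℂ) - α + 2) / 4,
          -((α : ℂ) + β) / 4] (((16 * r)⁻¹ : ℝ) : ℂ) (-w - ((α : ℂ) + β) / 4) =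
      (4 * Real.pi * (r ^ ((α + β) / 4)) : ℝ) * (Complex.Gamma w * Complex.Gamma (1 - w) *
        (Complex.Gamma (α + 2 * w) * Complex.Gamma (β + 2 * w)) * (r : ℂ) ^ w) := by
  have h1 := Gamma_mul_Gamma_half_shift α w
  have h2 := Gamma_mul_Gamma_half_shift β w
  -- The power of `16` is `2 ^ (4w + α + β)`, which cancels the duplication factors `2 ^ (2 - α - β
  -- - 4w)` down to `4`.
  have hz : (((16 * r)⁻¹ : ℝ) : ℂ) ^ (-w - ((α : ℂ) + β) / 4) *
      (((2 : ℂ) ^ (1 - (α : ℂ)) * 2 ^ (-(2 * w))) * ((2 : ℂ) ^ (1 - (β : ℂ)) * 2 ^ (-(2 * w)))) =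
      Complex.exp ((Real.log 2 : ℂ) * 2) * ((r ^ ((α + β) / 4) : ℝ) : ℂ) * (r : ℂ) ^ w := by
    have h16 : Real.log 16 = 4 * Real.log 2 := by
      rw [show (16 : ℝ) = 2 ^ 4 by norm_num, Real.log_pow]
      norm_num
    rw [← Complex.ofReal_ofNat 2]
    rw [Complex.ofReal_cpow hr.le, ofReal_cpow_eq_exp_log (by positivity),
      ofReal_cpow_eq_exp_log two_pos, ofReal_cpow_eq_exp_log two_pos,
      ofReal_cpow_eq_exp_log two_pos, ofReal_cpow_eq_exp_log hr, ofReal_cpow_eq_exp_log hr,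
      Real.log_inv, Real.log_mul (by norm_num) hr.ne', h16]
    simp only [← Complex.exp_add]
    congr 1
    push_cast
    ring
  have h4 : Complex.exp ((Real.log 2 : ℂ) * 2) = 4 := by
    rw [← ofReal_cpow_eq_exp_log two_pos]
    norm_num
  rw [h4] at hz
  have hpi : (√Real.pi : ℂ) * (√Real.pi : ℂ) = Real.pi := by
    rw [← Complex.ofReal_mul, Real.mul_self_sqrt Real.pi_pos.le]
  have e1 : ((α : ℂ) - β) / 4 - (-w - ((α : ℂ) + β) / 4) = α / 2 + w := by ring
  have e2 : ((α : ℂ) - β + 2) / 4 - (-w - ((α : ℂ) + β) / 4) = α / 2 + 1 / 2 + w := by ring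
  have e3 : ((β : ℂ) - α) / 4 - (-w - ((α : ℂ) + β) / 4) = β / 2 + w := by ring
  have e4 : ((β : ℂ) - α + 2) / 4 - (-w - ((α : ℂ) + β) / 4) = β / 2 + 1 / 2 + w := by ring
  have e5 : -((α : ℂ) + β) / 4 - (-w - ((α : ℂ) + β) / 4) = w := by ring
  have e6 : 1 - -((α : ℂ) + β) / 4 + (-w - ((α : ℂ) + β) / 4) = 1 - w := by ring
  have hP : meijerGIntegrand 5 1 ![(-((α : ℂ) + β) / 4)]
        ![((α : ℂ) - β) / 4, ((α : ℂ) - β + 2) / 4, ((β : ℂ) - α) / 4, ((β : ℂ) - α + 2) / 4,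
          -((α : ℂ) + β) / 4] (((16 * r)⁻¹ : ℝ) : ℂ) (-w - ((α : ℂ) + β) / 4) =
      (Complex.Gamma (α / 2 + w) * Complex.Gamma (α / 2 + 1 / 2 + w)) *
      (Complex.Gamma (β / 2 + w) * Complex.Gamma (β / 2 + 1 / 2 + w)) * Complex.Gamma w *
      Complex.Gamma (1 - w) * (((16 * r)⁻¹ : ℝ) : ℂ) ^ (-w - ((α : ℂ) + β) / 4) := by
    simp only [meijerGIntegrand, Fin.prod_univ_five, Fin.prod_univ_one]
    rw [if_pos (by decide), if_pos (by decide), if_pos (by decide), if_pos (by decide),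
      if_pos (by decide), if_pos (by decide)]
    simp only [Matrix.cons_val, e1, e2, e3, e4, e5, e6]
    ring
  rw [hP, h1, h2, Complex.ofReal_mul, Complex.ofReal_mul]
  calc _ = Complex.Gamma w * Complex.Gamma (1 - w) *
        (Complex.Gamma (α + 2 * w) * Complex.Gamma (β + 2 * w)) *
        ((√Real.pi : ℂ) * (√Real.pi : ℂ)) *
        ((((16 * r)⁻¹ : ℝ) : ℂ) ^ (-w - ((α : ℂ) + β) / 4) *
          (((2 : ℂ) ^ (1 - (α : ℂ)) * 2 ^ (-(2 * w))) *
            ((2 : ℂ) ^ (1 - (β : ℂ)) * 2 ^ (-(2 * w))))) := by ring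
    _ = _ := by
      rw [hpi, hz, Complex.ofReal_ofNat]
      ring

/-- The mean of `γ / (γ + b)` for a Gamma-Gamma SNR `γ`, in terms of the Meijer function. -/
theorem integral_div_add_gammaGamma_eq_meijerG {α β γb₂ b : ℝ} (hα : 0 < α) (hβ : 0 < β)
    (hγb₂ : 0 < γb₂) (hb : 0 < b) :
    ((∫ y, y / (y + b) ∂lawOfDensity (gammaGammaDensity α β γb₂) : ℝ) : ℂ) =
      ((((α * β) ^ ((α + β) / 2) * b ^ ((α + β) / 4) /
        (4 * Real.pi * (Real.Gamma α * Real.Gamma β) * γb₂ ^ ((α + β) / 4)) : ℝ)) : ℂ) *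
      meijerG 5 1 ![(-((α : ℂ) + β) / 4)]
        ![((α : ℂ) - β) / 4, ((α : ℂ) - β + 2) / 4, ((β : ℂ) - α) / 4, ((β : ℂ) - α + 2) / 4,
          -((α : ℂ) + β) / 4]
        (((α * β) ^ 2 * b / (16 * γb₂) : ℝ) : ℂ) := by
  set r : ℝ := γb₂ / ((α * β) ^ 2 * b) with hr
  have hr0 : 0 < r := by positivity
  have hz : (α * β) ^ 2 * b / (16 * γb₂) = (16 * r)⁻¹ := by
    rw [hr]
    field_simp
  have ha : ((-((α : ℂ) + β) / 4)).re = -(α + β) / 4 := by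
    norm_cast
  have hb1 : (((α : ℂ) - β) / 4).re = (α - β) / 4 := by norm_cast
  have hb2 : (((α : ℂ) - β + 2) / 4).re = (α - β + 2) / 4 := by norm_cast
  have hb3 : (((β : ℂ) - α) / 4).re = (β - α) / 4 := by norm_cast
  have hb4 : (((β : ℂ) - α + 2) / 4).re = (β - α + 2) / 4 := by norm_cast
  have hex : ∃ c : ℝ, MeijerGSeparates 5 1 ![(-((α : ℂ) + β) / 4)]
        ![((α : ℂ) - β) / 4, ((α : ℂ) - β + 2) / 4, ((β : ℂ) - α) / 4, ((β : ℂ) - α + 2) / 4,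
          -((α : ℂ) + β) / 4] c := by
    -- The midpoint of the separating strip: as `α, β > 0`, the least real part among the lower
    -- parameters is `-(α + β)/4`, the upper parameter.
    refine ⟨-(α + β) / 4 - 1 / 2, fun j _ => ?_, fun k _ => ?_⟩
    · fin_cases j
      · exact (by linarith : _ < (α - β) / 4).trans_eq hb1.symm
      · exact (by linarith : _ < (α - β + 2) / 4).trans_eq hb2.symm
      · exact (by linarith : _ < (β - α) / 4).trans_eq hb3.symm
      · exact (by linarith : _ < (β - α + 2) / 4).trans_eq hb4.symm
      · exact (by linarith : _ < -(α + β) / 4).trans_eq ha.symm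
    · rw [Subsingleton.elim k 0]
      have h : (-((α : ℂ) + β) / 4).re - 1 < -(α + β) / 4 - 1 / 2 := by linarith
      exact h
  have hc := hex.choose_spec
  rw [meijerG, dif_pos hex, hz]
  set c := hex.choose
  have hc1 : c < -(α + β) / 4 := (hc.1 4 (by decide)).trans_eq ha
  have hc2 : -(α + β) / 4 - 1 < c := by
    have h : (-((α : ℂ) + β) / 4).re - 1 < c := hc.2 0 (by decide)
    rwa [ha] at h
  -- Every separating abscissa `c` gives `0 < σ < 1`, so whichever line was chosen is admissible and
  -- no contour shift is needed. The reflection `y ↦ -y` below accounts for `w = -s - (α + β)/4`.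
  set σ := -c - (α + β) / 4 with hσ
  rw [integral_div_add_gammaGamma hα hβ hγb₂ hb (σ := σ) (by linarith) (by linarith),
    ← integral_neg_eq_self, ← integral_const_mul, ← integral_const_mul, ← integral_const_mul]
  refine integral_congr_ae (ae_of_all _ fun y => ?_)
  simp only
  set w : ℂ := (σ : ℂ) + ((-y : ℝ) : ℂ) * Complex.I with hw
  have hs : (c : ℂ) + y * Complex.I = -w - ((α : ℂ) + β) / 4 := by
    rw [hw, hσ]
    push_cast
    ring
  rw [hs, meijerGIntegrand_gammaGamma hr0]
  have hk : (α * β) ^ ((α + β) / 2) * b ^ ((α + β) / 4) /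
      (4 * Real.pi * (Real.Gamma α * Real.Gamma β) * γb₂ ^ ((α + β) / 4)) *
      (4 * Real.pi * r ^ ((α + β) / 4)) = 1 / (Real.Gamma α * Real.Gamma β) := by
    rw [hr, Real.div_rpow hγb₂.le (by positivity), Real.mul_rpow (by positivity) hb.le,
      ← Real.rpow_natCast (α * β) 2, ← Real.rpow_mul (by positivity),
      show ((2 : ℕ) : ℝ) * ((α + β) / 4) = (α + β) / 2 by push_cast; ring]
    have := Real.Gamma_pos_of_pos hα
    have := Real.Gamma_pos_of_pos hβ
    have : 0 < (α * β) ^ ((α + β) / 2) := by positivity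
    have : 0 < b ^ ((α + β) / 4) := by positivity
    have : 0 < γb₂ ^ ((α + β) / 4) := by positivity
    field_simp
  set F := Complex.Gamma w * Complex.Gamma (1 - w) *
    (Complex.Gamma (α + 2 * w) * Complex.Gamma (β + 2 * w)) * (r : ℂ) ^ w
  have hk' := congrArg Complex.ofReal hk
  rw [Complex.ofReal_mul, Complex.ofReal_div 1, Complex.ofReal_one,
    Complex.ofReal_mul (Real.Gamma α) (Real.Gamma β), ← Complex.Gamma_ofReal α,
    ← Complex.Gamma_ofReal β] at hk'
  linear_combination (-(1 / (2 * (Real.pi : ℂ))) * F) * hk'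

/-! ### Normalisation and mean of the RF law -/

/-- `lawOfDensity` sees only the positive part of `f`. If that part and `f` both have integral `1`,
the negative part has integral `0`. This spares a direct sign analysis of the alternating sum. -/
theorem ae_nonneg_of_lawOfDensity {f : ℝ → ℝ} (hf : Integrable f) (h1 : ∫ x, f x = 1)
    [IsProbabilityMeasure (lawOfDensity f)] : ∀ᵐ x, 0 ≤ f x := by
  have hu : ∫⁻ x, ENNReal.ofReal (f x) = 1 := by
    have h := measure_univ (μ := lawOfDensity f)
    rwa [lawOfDensity, withDensity_apply _ MeasurableSet.univ, Measure.restrict_univ] at h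
  have h := integral_eq_lintegral_pos_part_sub_lintegral_neg_part hf
  rw [h1, hu, ENNReal.toReal_one] at h
  have hn : ∫⁻ x, ENNReal.ofReal (-f x) = 0 := by
    have hfin : ∫⁻ x, ENNReal.ofReal (-f x) ≠ ⊤ := hf.neg.lintegral_lt_top.ne
    exact ((ENNReal.toReal_eq_zero_iff _).1 (by linarith)).resolve_right hfin
  rw [lintegral_eq_zero_iff' (by exact hf.aestronglyMeasurable.aemeasurable.neg.ennreal_ofReal)]
    at hn
  filter_upwards [hn] with x hx
  have := ENNReal.ofReal_eq_zero.1 hx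
  linarith

theorem integral_exp_neg_mul_Ioi {b : ℝ} (hb : 0 < b) :
    ∫ x in Set.Ioi (0 : ℝ), Real.exp (-(b * x)) = 1 / b := by
  have h := Real.integral_rpow_mul_exp_neg_mul_Ioi one_pos hb
  simpa using h

theorem integral_mul_exp_neg_mul_Ioi {b : ℝ} (hb : 0 < b) :
    ∫ x in Set.Ioi (0 : ℝ), x * Real.exp (-(b * x)) = 1 / b ^ 2 := by
  have h := Real.integral_rpow_mul_exp_neg_mul_Ioi two_pos hb
  rw [Real.Gamma_two, mul_one, show (2 : ℝ) - 1 = 1 by norm_num, Real.rpow_two] at h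
  simpa using h

/-- Partial fractions. By Pascal's rule the sum for `M + 1` is the difference of the sums for `M` at
`x` and `x + 1`. -/
theorem sum_range_neg_one_pow_choose_div (M : ℕ) : ∀ x : ℝ, 0 < x →
    ∑ n ∈ Finset.range (M + 1), (-1 : ℝ) ^ n * (M.choose n : ℝ) / (x + n) =
      (M.factorial : ℝ) / ∏ i ∈ Finset.range (M + 1), (x + i) := by
  induction M with
  | zero => intro x _; simp
  | succ M ih =>
    intro x hx
    have hrec : ∑ n ∈ Finset.range (M + 1 + 1), (-1 : ℝ) ^ n * ((M + 1).choose n : ℝ) / (x + n) =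
        ∑ n ∈ Finset.range (M + 1), (-1 : ℝ) ^ n * (M.choose n : ℝ) / (x + n) -
          ∑ n ∈ Finset.range (M + 1), (-1 : ℝ) ^ n * (M.choose n : ℝ) / (x + 1 + n) := by
      have h0 : ∑ n ∈ Finset.range (M + 1), (-1 : ℝ) ^ n * (M.choose n : ℝ) / (x + n) =
          ∑ n ∈ Finset.range (M + 1 + 1), (-1 : ℝ) ^ n * (M.choose n : ℝ) / (x + n) := by
        rw [Finset.sum_range_succ _ (M + 1)]
        simp
      rw [h0, Finset.sum_range_succ', Finset.sum_range_succ' _ (M + 1), add_sub_right_comm,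
        ← Finset.sum_sub_distrib]
      simp only [Nat.choose_zero_right]
      congr 1
      refine Finset.sum_congr rfl fun n _ => ?_
      rw [Nat.choose_succ_succ]
      push_cast
      rw [show x + 1 + (n : ℝ) = x + (n + 1) by ring]
      ring
    rw [hrec, ih x hx, ih (x + 1) (by linarith), Finset.prod_range_succ _ (M + 1),
      Finset.prod_range_succ' (fun i : ℕ => x + (i : ℝ)) M]
    have hP : ∏ i ∈ Finset.range (M + 1), (x + 1 + (i : ℝ)) =
        (∏ k ∈ Finset.range M, (x + ((k + 1 : ℕ) : ℝ))) * (x + (M + 1 : ℕ)) := by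
      rw [Finset.prod_range_succ]
      push_cast
      congr 1
      · exact Finset.prod_congr rfl fun k _ => by ring
      · ring
    rw [hP, Nat.factorial_succ]
    have hQ : 0 < ∏ k ∈ Finset.range M, (x + ((k + 1 : ℕ) : ℝ)) :=
      Finset.prod_pos fun k _ => by positivity
    have hx1 : 0 < x + (M + 1 : ℕ) := by positivity
    push_cast at hx1 hQ ⊢
    rw [add_zero]
    field_simp
    ring

/-- The total mass of the RF density, which does not depend on `ρ`: each scale cancels on
integration. -/
theorem mul_choose_mul_sum_eq_one {N m : ℕ} (hm : 1 ≤ m) (hmN : m ≤ N) :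
    (m : ℝ) * (N.choose m : ℝ) * ∑ n ∈ Finset.range m,
      (-1 : ℝ) ^ n * ((m - 1).choose n : ℝ) / ((N : ℝ) - m + n + 1) = 1 := by
  obtain ⟨M, rfl⟩ := Nat.exists_eq_add_of_le' hm
  obtain ⟨K, rfl⟩ := Nat.exists_eq_add_of_le' hmN
  have h := sum_range_neg_one_pow_choose_div M ((K : ℝ) + 1) (by positivity)
  have e : ∀ n : ℕ, ((K + (M + 1) : ℕ) : ℝ) - (M + 1 : ℕ) + n + 1 = (K : ℝ) + 1 + n := fun n => by
    push_cast
    ring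
  simp_rw [e, Nat.add_sub_cancel]
  rw [h]
  have hp : ∏ i ∈ Finset.range (M + 1), ((K : ℝ) + 1 + i) =
      ((K + 1).ascFactorial (M + 1) : ℝ) := by
    rw [Nat.ascFactorial_eq_prod_range]
    push_cast
    rfl
  have h1 : ((K + (M + 1)).choose (M + 1) : ℝ) * (K.factorial * ((M + 1) * M.factorial)) =
      K.factorial * ((K + 1).ascFactorial (M + 1) : ℝ) := by
    have := Nat.add_choose_mul_factorial_mul_factorial K (M + 1)
    have h' := Nat.factorial_mul_ascFactorial K (M + 1)
    rw [← h', Nat.factorial_succ] at this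
    have := congrArg (fun n : ℕ => (n : ℝ)) this
    push_cast at this
    linarith
  have hK : (0 : ℝ) < K.factorial := by exact_mod_cast K.factorial_pos
  have hA : (0 : ℝ) < (K + 1).ascFactorial (M + 1) := by
    exact_mod_cast Nat.ascFactorial_pos K (M + 1)
  rw [hp, mul_div_assoc', div_eq_one_iff_eq hA.ne']
  refine mul_left_cancel₀ hK.ne' ?_
  rw [← h1]
  push_cast
  ring

/-- First moment of a probability law whose density is a combination of exponentials. -/
theorem expSum_lawOfDensity {ι : Type*} {s : Finset ι} {A b : ι → ℝ} {f : ℝ → ℝ}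
    (hb : ∀ i ∈ s, 0 < b i) (hf0 : ∀ x < 0, f x = 0)
    (hf : ∀ x, 0 < x → f x = ∑ i ∈ s, A i * Real.exp (-(b i * x)))
    (h1 : ∑ i ∈ s, A i / b i = 1) [IsProbabilityMeasure (lawOfDensity f)] :
    Integrable (fun x => x) (lawOfDensity f) ∧
      ∫ x, x ∂lawOfDensity f = ∑ i ∈ s, A i / b i ^ 2 := by
  have hfe : f =ᵐ[volume] (Set.Ioi (0 : ℝ)).indicator
      (fun x => ∑ i ∈ s, A i * Real.exp (-(b i * x))) := by
    filter_upwards [Measure.ae_ne volume (0 : ℝ)] with x hx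
    rcases lt_or_gt_of_ne hx with h | h
    · rw [hf0 x h, Set.indicator_of_notMem (by simpa using h.le)]
    · rw [hf x h, Set.indicator_of_mem (Set.mem_Ioi.2 h)]
  have hi0 : ∀ i ∈ s, IntegrableOn (fun x : ℝ => A i * Real.exp (-(b i * x))) (Set.Ioi 0) := by
    intro i hi
    have := hb i hi
    refine (Integrable.of_integral_ne_zero ?_).const_mul _
    rw [integral_exp_neg_mul_Ioi this]
    positivity
  have hi1 : ∀ i ∈ s, IntegrableOn (fun x : ℝ => A i * (x * Real.exp (-(b i * x))))
      (Set.Ioi 0) := by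
    intro i hi
    have := hb i hi
    refine (Integrable.of_integral_ne_zero ?_).const_mul _
    rw [integral_mul_exp_neg_mul_Ioi this]
    positivity
  have hfi : Integrable f := by
    rw [integrable_congr hfe, integrable_indicator_iff measurableSet_Ioi]
    exact integrable_finsetSum s hi0
  have hfx : (fun x => f x * x) =ᵐ[volume] (Set.Ioi (0 : ℝ)).indicator
      (fun x => ∑ i ∈ s, A i * (x * Real.exp (-(b i * x)))) := by
    filter_upwards [hfe] with x hx
    rw [hx]
    by_cases h : x ∈ Set.Ioi (0 : ℝ)
    · rw [Set.indicator_of_mem h, Set.indicator_of_mem h, Finset.sum_mul]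
      exact Finset.sum_congr rfl fun i _ => by ring
    · rw [Set.indicator_of_notMem h, Set.indicator_of_notMem h, zero_mul]
  have hfxi : Integrable (fun x => f x * x) := by
    rw [integrable_congr hfx, integrable_indicator_iff measurableSet_Ioi]
    exact integrable_finsetSum s hi1
  have hI : ∫ x, f x = 1 := by
    rw [integral_congr_ae hfe, integral_indicator measurableSet_Ioi, integral_finsetSum s hi0,
      ← h1]
    refine Finset.sum_congr rfl fun i hi => ?_
    rw [integral_const_mul, integral_exp_neg_mul_Ioi (hb i hi), mul_one_div]
  have hpos := ae_nonneg_of_lawOfDensity hfi hI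
  have htr : (fun x => (ENNReal.ofReal (f x)).toReal • x) =ᵐ[volume] fun x => f x * x := by
    filter_upwards [hpos] with x hx
    rw [ENNReal.toReal_ofReal hx, smul_eq_mul]
  have hm : AEMeasurable (fun x => ENNReal.ofReal (f x)) :=
    hfi.aestronglyMeasurable.aemeasurable.ennreal_ofReal
  constructor
  · rw [lawOfDensity, integrable_withDensity_iff_integrable_smul₀' hm
      (ae_of_all _ fun x => ENNReal.ofReal_lt_top), integrable_congr htr]
    exact hfxi
  · rw [lawOfDensity, integral_withDensity_eq_integral_toReal_smul₀ hm
      (ae_of_all _ fun x => ENNReal.ofReal_lt_top), integral_congr_ae htr, integral_congr_ae hfx,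
      integral_indicator measurableSet_Ioi, integral_finsetSum s hi1]
    refine Finset.sum_congr rfl fun i hi => ?_
    rw [integral_const_mul, integral_mul_exp_neg_mul_Ioi (hb i hi), mul_one_div]

theorem rayleighPRS_mean {N m : ℕ} (hm : 1 ≤ m) (hmN : m ≤ N) {ρ γb₁ : ℝ}
    (hρ₁ : ρ ≤ 1) (hγb₁ : 0 < γb₁)
    [IsProbabilityMeasure (lawOfDensity (rayleighPRSDensity N m ρ γb₁))] :
    Integrable (fun x => x) (lawOfDensity (rayleighPRSDensity N m ρ γb₁)) ∧
      ∫ x, x ∂lawOfDensity (rayleighPRSDensity N m ρ γb₁) =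
        (m : ℝ) * (N.choose m : ℝ) * ∑ n ∈ Finset.range m, ((m - 1).choose n : ℝ) *
          ((-1 : ℝ) ^ n * ((((N : ℝ) - m + n) * (1 - ρ) + 1) * γb₁) /
            ((N : ℝ) - m + n + 1) ^ 2) := by
  have hNm : (0 : ℝ) ≤ (N : ℝ) - m := sub_nonneg.2 (by exact_mod_cast hmN)
  have hd : ∀ n : ℕ, 0 < (((N : ℝ) - m + n) * (1 - ρ) + 1) * γb₁ := fun n => by
    have : 0 ≤ ((N : ℝ) - m + n) * (1 - ρ) := mul_nonneg (by positivity) (by linarith)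
    positivity
  have ha : ∀ n : ℕ, 0 < (N : ℝ) - m + n + 1 := fun n => by positivity
  have h := expSum_lawOfDensity (s := Finset.range m) (f := rayleighPRSDensity N m ρ γb₁)
    (A := fun n : ℕ => (m : ℝ) * (N.choose m : ℝ) *
      ((-1 : ℝ) ^ n / ((((N : ℝ) - m + n) * (1 - ρ) + 1) * γb₁) * ((m - 1).choose n : ℝ)))
    (b := fun n : ℕ => ((N : ℝ) - m + n + 1) / ((((N : ℝ) - m + n) * (1 - ρ) + 1) * γb₁))
    (fun n _ => div_pos (ha n) (hd n)) (fun x hx => by simp [rayleighPRSDensity, not_le.2 hx])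
    (fun x hx => ?_) ?_
  · refine ⟨h.1, h.2.trans ?_⟩
    rw [Finset.mul_sum]
    refine Finset.sum_congr rfl fun n _ => ?_
    have := (ha n).ne'
    have := (hd n).ne'
    generalize (((N : ℝ) - m + n) * (1 - ρ) + 1) * γb₁ = d at *
    field_simp
  · rw [rayleighPRSDensity, if_pos hx.le, Finset.mul_sum]
    refine Finset.sum_congr rfl fun n _ => ?_
    rw [neg_div, mul_div_right_comm]
    ring
  · refine Eq.trans ?_ (mul_choose_mul_sum_eq_one hm hmN)
    rw [Finset.mul_sum]
    refine Finset.sum_congr rfl fun n _ => ?_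
    have := (ha n).ne'
    have := (hd n).ne'
    generalize (((N : ℝ) - m + n) * (1 - ρ) + 1) * γb₁ = d at *
    field_simp

/-! ### Jensen's inequality for the capacity -/

/-- A concave function lies below its tangent at `j`: `log` is bounded by its own tangent, then
`x/(a x + 1)` by its tangent, with an explicit square as defect. At `j = 0` this gives
integrability, at the mean Jensen's inequality. -/
theorem log_one_add_div_le_tangent {a x j : ℝ} (ha : 0 ≤ a) (hx : 0 ≤ x) (hj : 0 ≤ j) :
    Real.log (1 + x / (a * x + 1)) ≤ Real.log (1 + j / (a * j + 1)) +
      (1 / (a * j + 1) ^ 2 / (1 + j / (a * j + 1))) * (x - j) := by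
  have hX : 0 < a * x + 1 := by positivity
  have hJ : 0 < a * j + 1 := by positivity
  have hu : 0 < 1 + x / (a * x + 1) := by positivity
  have hv : 0 < 1 + j / (a * j + 1) := by positivity
  have h1 := Real.log_le_sub_one_of_pos (div_pos hu hv)
  rw [Real.log_div hu.ne' hv.ne'] at h1
  have h2 : (1 / (a * j + 1) ^ 2) * (x - j) -
      ((1 + x / (a * x + 1)) - (1 + j / (a * j + 1))) =
      a * (x - j) ^ 2 / ((a * j + 1) ^ 2 * (a * x + 1)) := by
    field_simp
    ring
  have h3 : 0 ≤ a * (x - j) ^ 2 / ((a * j + 1) ^ 2 * (a * x + 1)) := by positivity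
  have h4 : (1 + x / (a * x + 1)) / (1 + j / (a * j + 1)) - 1 ≤
      (1 / (a * j + 1) ^ 2 / (1 + j / (a * j + 1))) * (x - j) := by
    rw [div_sub_one hv.ne', div_mul_eq_mul_div]
    gcongr
    linarith
  linarith

section capacity

variable {Ω : Type*} [MeasurableSpace Ω] {P : Measure Ω}

theorem integrable_log_one_add_div {a : ℝ} (ha : 0 ≤ a) {X : Ω → ℝ} (hX : Integrable X P)
    (hX0 : ∀ᵐ w ∂P, 0 ≤ X w) :
    Integrable (fun w => Real.log (1 + X w / (a * X w + 1))) P := by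
  have hm := hX.aestronglyMeasurable.aemeasurable
  refine hX.mono' (AEMeasurable.aestronglyMeasurable (by fun_prop)) ?_
  filter_upwards [hX0] with w hw
  have h := log_one_add_div_le_tangent ha hw le_rfl
  have h0 : 0 ≤ Real.log (1 + X w / (a * X w + 1)) :=
    Real.log_nonneg (le_add_of_nonneg_right (by positivity))
  rw [Real.norm_of_nonneg h0]
  simpa using h

/-- Jensen's inequality for `x ↦ log (1 + x / (a x + 1))`. -/
theorem integral_log_one_add_div_le [IsProbabilityMeasure P] {a : ℝ} (ha : 0 ≤ a) {X : Ω → ℝ} (hX : Integrable X P)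
    (hX0 : ∀ᵐ w ∂P, 0 ≤ X w) :
    ∫ w, Real.log (1 + X w / (a * X w + 1)) ∂P ≤
      Real.log (1 + (∫ w, X w ∂P) / (a * (∫ w, X w ∂P) + 1)) := by
  set j := ∫ w, X w ∂P with hj
  have hj0 : 0 ≤ j := integral_nonneg_of_ae hX0
  have hs : Integrable (fun w => X w - j) P := hX.sub (integrable_const j)
  refine (integral_mono_ae (integrable_log_one_add_div ha hX hX0)
    ((integrable_const _).add (hs.const_mul _)) (hX0.mono fun w hw =>
      log_one_add_div_le_tangent ha hw hj0)).trans_eq ?_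
  simp only [Pi.add_apply]
  rw [integral_add (integrable_const _) (hs.const_mul _), integral_const_mul,
    integral_sub hX (integrable_const j)]
  simp [← hj]

end capacity

/-! ### Assembly of the theorem -/

theorem sndr_eq_div {I κ e x y : ℝ} (hI : 0 ≤ I) (hκ : 0 < κ) (he : 0 ≤ e) (hy : 0 < y) :
    sndr I κ e x y =
      (x * y / sndrTau I κ e y) / (I * (x * y / sndrTau I κ e y) + 1) := by
  have hτ : 0 < sndrTau I κ e y := by
    unfold sndrTau
    positivity
  have h : I * (x * y / sndrTau I κ e y) + 1 =
      (I * x * y + (1 + I) * κ * y + (1 + I) * (e + κ)) / sndrTau I κ e y := by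
    rw [eq_div_iff hτ.ne', add_mul, one_mul, mul_assoc, div_mul_cancel₀ _ hτ.ne', sndrTau]
    ring
  rw [h, div_div_div_cancel_right₀ hτ.ne', sndr]

theorem div_sndrTau {I κ e : ℝ} (hκ : κ ≠ 0) (y : ℝ) :
    y / sndrTau I κ e y = 1 / ((1 + I) * κ) * (y / (y + (e + κ) / κ)) := by
  have h : sndrTau I κ e y = ((1 + I) * κ) * (y + (e + κ) / κ) := by
    unfold sndrTau
    field_simp
  rw [h, div_mul_div_comm, one_mul]

theorem theorem1 {Ω : Type*} [MeasurableSpace Ω] (P : Measure Ω) [IsProbabilityMeasure P]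
    -- relays, rank of the selected relay, time correlation, fading parameters
    (N m : ℕ) (hm : 1 ≤ m) (hmN : m ≤ N) (ρ : ℝ) (hρ₀ : 0 ≤ ρ) (hρ₁ : ρ ≤ 1)
    (α β γb₁ γb₂ : ℝ) (hα : 0 < α) (hβ : 0 < β) (hγb₁ : 0 < γb₁) (hγb₂ : 0 < γb₂)
    -- hardware: IQ imbalance, powers, linear scale and distortion of the relay amplifier
    (ζ θ σ σ₀ P₁ δ σd : ℝ) (hω : iqOmega₁ ζ θ ≠ 0) (hσ : 0 < σ) (hσ₀ : 0 < σ₀) (hP₁ : 0 < P₁)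
    (hδ : δ ≠ 0)
    -- RF fading coefficient and the instantaneous SNRs of the two hops
    (h : Ω → ℂ) (γ₁ γ₂ : Ω → ℝ) (hγ₁ : ∀ w, γ₁ w = P₁ * ‖h w‖ ^ 2 / σ₀ ^ 2)
    (hlaw₁ : HasLaw γ₁ (lawOfDensity (rayleighPRSDensity N m ρ γb₁)) P)
    (hlaw₂ : HasLaw γ₂ (lawOfDensity (gammaGammaDensity α β γb₂)) P)
    (hind : IndepFun γ₁ γ₂ P)
    -- derived quantities
    (ILR κ e₁ C J : ℝ)
    (hILR : ILR = imageLeakageRatio ζ θ)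
    (hκ : κ = relayKappa δ σd (relayGain σ σ₀ P₁ (∫ w, ‖h w‖ ^ 2 ∂P)) σ₀)
    (he₁ : e₁ = ∫ w, γ₁ w ∂P)
    (hC : C = 1 / 2 * ∫ w, Real.logb 2 (1 + sndr ILR κ e₁ (γ₁ w) (γ₂ w)) ∂P)
    (hJ : J = ∫ w, γ₁ w * γ₂ w / sndrTau ILR κ e₁ (γ₂ w) ∂P) :
    -- all expectations involved are finite
    Integrable γ₁ P ∧
    Integrable (fun w => Real.logb 2 (1 + sndr ILR κ e₁ (γ₁ w) (γ₂ w))) P ∧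
    Integrable (fun w => γ₁ w * γ₂ w / sndrTau ILR κ e₁ (γ₂ w)) P ∧
    -- the upper bound
    C ≤ 1 / 2 * Real.logb 2 (1 + J / (ILR * J + 1)) ∧
    -- the closed form
    (J : ℂ) =
      (((m : ℝ) * (N.choose m : ℝ) * (α * β) ^ ((α + β) / 2) *
            ((e₁ + κ) / κ) ^ ((α + β) / 4) /
          (4 * Real.pi * (1 + ILR) * κ * Real.Gamma α * Real.Gamma β * γb₂ ^ ((α + β) / 4)) *
        ∑ n ∈ Finset.range m, ((m - 1).choose n : ℝ) *
          ((-1 : ℝ) ^ n * ((((N : ℝ) - m + n) * (1 - ρ) + 1) * γb₁) /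
            ((N : ℝ) - m + n + 1) ^ 2) : ℝ) : ℂ) *
      meijerG 5 1 ![(-((α : ℂ) + β) / 4)]
        ![((α : ℂ) - β) / 4, ((α : ℂ) - β + 2) / 4, ((β : ℂ) - α) / 4, ((β : ℂ) - α + 2) / 4,
          -((α : ℂ) + β) / 4]
        (((α * β) ^ 2 * (e₁ + κ) / (16 * κ * γb₂) : ℝ) : ℂ) := by
  have hp₁ : IsProbabilityMeasure (lawOfDensity (rayleighPRSDensity N m ρ γb₁)) :=
    hlaw₁.map_eq ▸ Measure.isProbabilityMeasure_map hlaw₁.aemeasurable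
  obtain ⟨hint₁, hmean₁⟩ := rayleighPRS_mean hm hmN hρ₁ hγb₁
  have hγ₁0 : ∀ w, 0 ≤ γ₁ w := fun w => by rw [hγ₁]; positivity
  have hγ₂0 : ∀ᵐ w ∂P, 0 < γ₂ w :=
    ae_of_ae_map hlaw₂.aemeasurable (hlaw₂.map_eq ▸ ae_pos_gammaGamma hα hβ hγb₂)
  have hI0 : 0 ≤ ILR := by rw [hILR]; exact sq_nonneg _
  have hκ0 : 0 < κ := by
    rw [hκ]
    unfold relayKappa
    positivity
  have he0 : 0 ≤ e₁ := he₁ ▸ integral_nonneg hγ₁0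
  have hintγ₁ : Integrable γ₁ P := by
    rw [← hlaw₁.map_eq] at hint₁
    exact hint₁.comp_aemeasurable hlaw₁.aemeasurable
  have hm₁ := hlaw₁.aemeasurable
  have hm₂ := hlaw₂.aemeasurable
  have hb : 0 < (e₁ + κ) / κ := by positivity
  have hfac : ∀ w, γ₁ w * γ₂ w / sndrTau ILR κ e₁ (γ₂ w) =
      γ₁ w * (1 / ((1 + ILR) * κ) * (γ₂ w / (γ₂ w + (e₁ + κ) / κ))) := fun w => by
    rw [mul_div_assoc, div_sndrTau hκ0.ne']
  have hX0 : ∀ᵐ w ∂P, 0 ≤ γ₁ w * γ₂ w / sndrTau ILR κ e₁ (γ₂ w) := by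
    filter_upwards [hγ₂0] with w hw
    rw [hfac]
    have := hγ₁0 w
    positivity
  have hX : Integrable (fun w => γ₁ w * γ₂ w / sndrTau ILR κ e₁ (γ₂ w)) P := by
    -- The ratio `γ₂/(γ₂ + b)` is at most `1`, so a multiple of `γ₁` dominates.
    refine (hintγ₁.mul_const (1 / ((1 + ILR) * κ))).mono' ?_ ?_
    · unfold sndrTau
      exact AEMeasurable.aestronglyMeasurable (by fun_prop)
    · filter_upwards [hX0, hγ₂0] with w hw hw2
      rw [Real.norm_of_nonneg hw, hfac]
      refine mul_le_mul_of_nonneg_left ?_ (hγ₁0 w)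
      refine mul_le_of_le_one_right (by positivity) ?_
      rw [div_le_one (by positivity)]
      linarith
  have hlog : (fun w => Real.logb 2 (1 + sndr ILR κ e₁ (γ₁ w) (γ₂ w))) =ᵐ[P] fun w =>
      Real.log (1 + (γ₁ w * γ₂ w / sndrTau ILR κ e₁ (γ₂ w)) /
        (ILR * (γ₁ w * γ₂ w / sndrTau ILR κ e₁ (γ₂ w)) + 1)) / Real.log 2 := by
    filter_upwards [hγ₂0] with w hw
    rw [sndr_eq_div hI0 hκ0 he0 hw, Real.logb]
  refine ⟨hintγ₁, ?_, hX, ?_, ?_⟩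
  · rw [integrable_congr hlog]
    exact (integrable_log_one_add_div hI0 hX hX0).div_const _
  · rw [hC, hJ, integral_congr_ae hlog, integral_div, Real.logb]
    have h2 : 0 < Real.log 2 := Real.log_pos one_lt_two
    gcongr
    exact integral_log_one_add_div_le hI0 hX hX0
  · have hφm : Measurable fun y : ℝ => y / (y + (e₁ + κ) / κ) := by fun_prop
    have hJr : J = ((m : ℝ) * (N.choose m : ℝ) * ∑ n ∈ Finset.range m, ((m - 1).choose n : ℝ) *
          ((-1 : ℝ) ^ n * ((((N : ℝ) - m + n) * (1 - ρ) + 1) * γb₁) /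
            ((N : ℝ) - m + n + 1) ^ 2)) * (1 / ((1 + ILR) * κ) *
        ∫ y, y / (y + (e₁ + κ) / κ) ∂lawOfDensity (gammaGammaDensity α β γb₂)) := by
      rw [hJ, integral_congr_ae (ae_of_all _ hfac), ← hmean₁, ← hlaw₁.integral_eq,
        ← hlaw₂.integral_comp hφm.aestronglyMeasurable, ← integral_const_mul]
      -- Independence factors the expectation, as `hfac` has separated the two SNRs.
      exact hind.integral_fun_comp_mul_comp hm₁ hm₂ (f := fun x => x)
        (g := fun y => 1 / ((1 + ILR) * κ) * (y / (y + (e₁ + κ) / κ)))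
        measurable_id.aestronglyMeasurable (hφm.const_mul _).aestronglyMeasurable
    have hz : (α * β) ^ 2 * (e₁ + κ) / (16 * κ * γb₂) =
        (α * β) ^ 2 * ((e₁ + κ) / κ) / (16 * γb₂) := by
      field_simp
    generalize (∑ n ∈ Finset.range m, ((m - 1).choose n : ℝ) *
      ((-1 : ℝ) ^ n * ((((N : ℝ) - m + n) * (1 - ρ) + 1) * γb₁) /
        ((N : ℝ) - m + n + 1) ^ 2)) = S at hJr ⊢
    rw [hJr, hz, ← mul_assoc, Complex.ofReal_mul,
      integral_div_add_gammaGamma_eq_meijerG hα hβ hγb₂ hb, ← mul_assoc, ← Complex.ofReal_mul]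
    congr 2
    simp only [div_eq_mul_inv, mul_inv]
    ring
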